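/- All graphs are finite, simple and undirected. For graphs $H,G$ write $H\prec G$ if $G$ has an induced subgraph isomorphic to $H$. Let $\mathcal H$ be a (finite or infinite) family of graphs. A graph $G$ is $\mathcal H$-free if $H\prec G$ for no $H\in\mathcal H$, and for families $\mathcal H_1,\mathcal H_2$ write $\mathcal H_1\le\mathcal H_2$ if for every $H_2\in\mathcal H_2$ there is $H_1\in\mathcal H_1$ with $H_1\prec H_2$. For a vertex $v$ of $G$ let $c_L(v)$ be the number of connected components of the subgraph of $G$ induced by the neighbourhood $N(v)$. Let $K_n$, $E_n$, $P_n$ be the complete graph, the edgeless graph and the path on $n$ vertices, and $K_{s,t}$ the complete bipartite graph. Let $K_n^*$ be obtained from $K_n$ by adding a pendant vertex at each vertex; $K_{1,n}^*$ from the star $K_{1,n}$ by adding a pendant vertex at each of its $n$ leaves; $CK_n$ from two disjoint copies of $K_n$ by adding a perfect matching between them; and $T_n$ from the join of $K_n$ and $E_n$ (the disjoint union together with all edges between the two parts) by adding one new vertex adjacent exactly to the vertices of $E_n$. **Theorem.** The following are equivalent: 1. there is a constant $c=c(\mathcal H)$ such that $\#\{v\in V(G): c_L(v)\ge 2\}<c$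 for every connected $\mathcal H$-free graph $G$; 2. $\mathcal H\le\{K_n^*,\,K_{1,n}^*,\,P_n,\,K_{2,n},\,CK_n,\,T_n\}$ for some positive integer $n$. -/

import Mathlib

universe u v

open scoped SimpleGraph

/-- A finite simple graph, bundled with its vertex type. -/
structure FinGraph : Type (u + 1) where
  V : Type u
  finite : Finite V
  graph : SimpleGraph V

/-- An (unbundled) simple graph on a finite type, as a finite graph. -/
def FinGraph.of {V : Type u} [h : Finite V] (G : SimpleGraph V) : FinGraph.{u} := ⟨V, h, G⟩

/-- `H ≺ G`: the graph `G` contains an induced subgraph isomorphic to `H`. -/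
def FinGraph.Prec (H : FinGraph.{u}) (G : FinGraph.{v}) : Prop :=
  H.graph.IsIndContained G.graph

/-- `G` is `𝓗`-free: no member of `𝓗` is isomorphic to an induced subgraph of `G`. -/
def FinGraph.IsFree (G : FinGraph.{v}) (𝓗 : Set FinGraph.{u}) : Prop :=
  ∀ H ∈ 𝓗, ¬ H.Prec G

/-- `𝓗₁ ≤ 𝓗₂`: every member of `𝓗₂` contains some member of `𝓗₁` as an induced subgraph. -/
def FamilyLE (𝓗₁ : Set FinGraph.{u}) (𝓗₂ : Set FinGraph.{v}) : Prop :=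
  ∀ H₂ ∈ 𝓗₂, ∃ H₁ ∈ 𝓗₁, H₁.Prec H₂

/-- `p_k(G)`: the number of vertices `v` of `G` with `p(v) ≥ k`. -/
noncomputable def countGE (p : (G : FinGraph.{u}) → G.V → ℕ) (k : ℕ) (G : FinGraph.{u}) : ℕ :=
  {v : G.V | k ≤ p G v}.ncard

/-- `B₁(p)`: the families `𝓗` such that `p₂(G)` is bounded over all connected `𝓗`-free graphs. -/
def B₁ (p : (G : FinGraph.{u}) → G.V → ℕ) : Set (Set FinGraph.{u}) :=
  {𝓗 | ∃ c : ℕ, ∀ G : FinGraph.{u}, G.graph.Connected → G.IsFree 𝓗 → countGE p 2 G < c}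

/-- The local component number of `v`: the number of connected components of the subgraph
induced by the neighbourhood of `v` (it is `0` if `v` is isolated). -/
noncomputable def localComponentNumber (G : FinGraph.{u}) (v : G.V) : ℕ :=
  Nat.card (G.graph.induce (G.graph.neighborSet v)).ConnectedComponent

/-- Add to `G`, for each `i : ι`, a new vertex whose only neighbour is `f i`. -/
def addPendants {V : Type u} {ι : Type v} (G : SimpleGraph V) (f : ι → V) :
    SimpleGraph (V ⊕ ι) where
  Adj
    | .inl a, .inl b => G.Adj a b
    | .inl a, .inr i => a = f i
    | .inr i, .inl a => a = f i
    | .inr _, .inr _ => False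
  symm := ⟨by
    rintro (a | i) (b | j) h
    · exact SimpleGraph.Adj.symm h
    · exact h
    · exact h
    · exact h⟩
  loopless := ⟨by
    rintro (a | i) h
    · exact G.irrefl h
    · exact h⟩

/-- The join of two graphs: their disjoint union together with all edges between them. -/
def graphJoin {V : Type u} {W : Type v} (G : SimpleGraph V) (H : SimpleGraph W) :
    SimpleGraph (V ⊕ W) :=
  (G ⊕g H) ⊔ completeBipartiteGraph V W

/-- Add to `G` one new vertex (`none`), adjacent exactly to the vertices in `S`. -/
def addVertex {V : Type u} (G : SimpleGraph V) (S : Set V) : SimpleGraph (Option V) where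
  Adj
    | some a, some b => G.Adj a b
    | some a, none => a ∈ S
    | none, some a => a ∈ S
    | none, none => False
  symm := ⟨by
    rintro (_ | a) (_ | b) h
    · exact h
    · exact h
    · exact h
    · exact SimpleGraph.Adj.symm h⟩
  loopless := ⟨by
    rintro (_ | a) h
    · exact h
    · exact G.irrefl h⟩

/-- `K_n^*`: the complete graph `K_n` with a pendant added to each vertex. -/
def cliqueWithPendants (n : ℕ) : SimpleGraph (Fin n ⊕ Fin n) :=
  addPendants (⊤ : SimpleGraph (Fin n)) id

/-- `K_{1,n}^*`: the star `K_{1,n}` with a pendant added to each of its `n` leaves. -/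
def spider (n : ℕ) : SimpleGraph ((Fin 1 ⊕ Fin n) ⊕ Fin n) :=
  addPendants (completeBipartiteGraph (Fin 1) (Fin n)) Sum.inr

/-- `CK_n`: two disjoint copies of `K_n` joined by a perfect matching. -/
def matchedCliques (n : ℕ) : SimpleGraph (Fin n ⊕ Fin n) where
  Adj
    | .inl i, .inl j => i ≠ j
    | .inr i, .inr j => i ≠ j
    | .inl i, .inr j => i = j
    | .inr i, .inl j => i = j
  symm := ⟨by
    rintro (i | i) (j | j) h
    · exact Ne.symm h
    · exact Eq.symm h
    · exact Eq.symm h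
    · exact Ne.symm h⟩
  loopless := ⟨by rintro (i | i) h <;> exact h rfl⟩

/-- `T_n`: the join `K_n + E_n` together with a new vertex adjacent exactly to the vertices
of `E_n`. -/
def graphT (n : ℕ) : SimpleGraph (Option (Fin n ⊕ Fin n)) :=
  addVertex (graphJoin (⊤ : SimpleGraph (Fin n)) (⊥ : SimpleGraph (Fin n))) (Set.range Sum.inr)

/-- The family `{K_n^*, K_{1,n}^*, P_n, K_{2,n}, CK_n, T_n}`. -/
def unavoidableFamily (n : ℕ) : Set FinGraph.{0} :=
  {FinGraph.of (cliqueWithPendants n),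
   FinGraph.of (spider n),
   FinGraph.of (SimpleGraph.pathGraph n),
   FinGraph.of (completeBipartiteGraph (Fin 2) (Fin n)),
   FinGraph.of (matchedCliques n),
   FinGraph.of (graphT n)}

open Finset

/-! For 1 ⇒ 2, each of the six graphs with parameter `c + 2` is connected and has at least `c`
vertices whose neighbourhood has an isolated vertex but is not a single point. None of them can
therefore be `𝓗`-free (`exists_prec_of_connected`).

For 2 ⇒ 1, call a vertex special if its neighbourhood is disconnected. Excluding `P_n` bounds all
distances from a root, so many special vertices force many in one distance layer.
`exists_le_card_filter_adj_of_dist_eq` then finds a vertex `w` adjacent to many of these, and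
Ramsey's theorem yields a large clique or a large independent set of special neighbours of `w`. Each
member `a` of this set `A` gets a neighbour `g a` in another component of its neighbourhood: away
from the rest of the clique in the first case, away from `w` in the second.

The common tool is a sparse matching between `A` and `g(A)`. Ramsey arguments make it induced and
both sides homogeneous. A clique on either side gives `CK_n` or `K_n^*`, so both sides become
independent. This contradicts `A` being a clique; in the independent case `w` completes a
`K_{1,n}^*`, where sparsity comes from excluding `K_{2,n}`. As `T_n` contains an induced `K_{2,n}`,
it imposes no separate condition in this direction. -/

/-- Ramsey's theorem for graphs, inside a finite set of vertices. -/
theorem exists_ramsey (k l : ℕ) : ∃ N : ℕ, ∀ (V : Type u) (G : SimpleGraph V) (A : Finset V),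
    N ≤ #A → ∃ B ⊆ A, (k ≤ #B ∧ G.IsClique B) ∨ (l ≤ #B ∧ G.IsIndepSet B) := by
  classical
  induction k generalizing l with
  | zero => exact ⟨0, fun V G A _ => ⟨∅, by simp⟩⟩
  | succ k ihk =>
    induction l with
    | zero => exact ⟨0, fun V G A _ => ⟨∅, by simp⟩⟩
    | succ l ihl =>
      obtain ⟨N₁, h₁⟩ := ihk (l + 1)
      obtain ⟨N₂, h₂⟩ := ihl
      refine ⟨N₁ + N₂ + 1, fun V G A hA => ?_⟩
      obtain ⟨v, hv⟩ : A.Nonempty := card_pos.1 (by omega)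
      have hcard : #((A.erase v).filter (G.Adj v)) + #((A.erase v).filter (¬ G.Adj v ·)) + 1
          = #A := by
        rw [card_filter_add_card_filter_not, card_erase_add_one hv]
      have hsub : ∀ (p : V → Prop) [DecidablePred p], (A.erase v).filter p ⊆ A :=
        fun p _ => (filter_subset _ _).trans (erase_subset _ _)
      rcases (by omega : N₁ ≤ #((A.erase v).filter (G.Adj v)) ∨
        N₂ ≤ #((A.erase v).filter (¬ G.Adj v ·))) with h | h
      · obtain ⟨B, hBA, hB | hB⟩ := h₁ V G _ h
        · have hvB : v ∉ B := fun hvB => by simpa using hBA hvB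
          refine ⟨insert v B, insert_subset hv (hBA.trans (hsub _)), Or.inl ⟨?_, ?_⟩⟩
          · rw [card_insert_of_notMem hvB]; omega
          · rw [coe_insert]
            exact hB.2.insert fun b hb _ => (mem_filter.1 (hBA hb)).2
        · exact ⟨B, hBA.trans (hsub _), Or.inr hB⟩
      · obtain ⟨B, hBA, hB | hB⟩ := h₂ V G _ h
        · exact ⟨B, hBA.trans (hsub _), Or.inl hB⟩
        · have hvB : v ∉ B := fun hvB => by simpa using hBA hvB
          refine ⟨insert v B, insert_subset hv (hBA.trans (hsub _)), Or.inr ⟨?_, ?_⟩⟩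
          · rw [card_insert_of_notMem hvB]; omega
          · rw [coe_insert, SimpleGraph.isIndepSet_iff]
            refine Set.Pairwise.insert hB.2 fun b hb _ => ?_
            have := (mem_filter.1 (hBA hb)).2
            exact ⟨this, fun h => this h.symm⟩

/-! ### Sparse matchings and how to clean them. -/

open scoped Classical in
/-- Every `a ∈ A` has a neighbour `g a` outside `A` that has fewer than `D` neighbours in `A`. -/
structure IsSparselyMatched {V : Type u} (G : SimpleGraph V) (A : Finset V) (g : V → V)
    (D : ℕ) : Prop where
  adj : ∀ a ∈ A, G.Adj (g a) a
  notMem : ∀ a ∈ A, g a ∉ A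
  card_lt : ∀ a ∈ A, #{b ∈ A | G.Adj (g a) b} < D

/-- The edges between `A` and `g '' A ⊆ Aᶜ` are exactly the edges `{a, g a}`. -/
structure IsInducedMatching {V : Type u} (G : SimpleGraph V) (A : Finset V) (g : V → V) :
    Prop where
  adj_iff : ∀ a ∈ A, ∀ b ∈ A, G.Adj (g a) b ↔ a = b
  notMem : ∀ a ∈ A, g a ∉ A

theorem IsSparselyMatched.mono {V : Type u} {G : SimpleGraph V} {A B : Finset V} {g : V → V}
    {D : ℕ} (h : IsSparselyMatched G A g D) (hBA : B ⊆ A) : IsSparselyMatched G B g D where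
  adj a ha := h.adj a (hBA ha)
  notMem a ha hb := h.notMem a (hBA ha) (hBA hb)
  card_lt a ha := by
    classical
    exact (card_le_card (filter_subset_filter _ hBA)).trans_lt (h.card_lt a (hBA ha))

theorem IsInducedMatching.mono {V : Type u} {G : SimpleGraph V} {A B : Finset V} {g : V → V}
    (h : IsInducedMatching G A g) (hBA : B ⊆ A) : IsInducedMatching G B g where
  adj_iff a ha b hb := h.adj_iff a (hBA ha) b (hBA hb)
  notMem a ha hb := h.notMem a (hBA ha) (hBA hb)

/-- A large sparsely matched set contains a subset of given size on which `g` does not reach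
later elements, with respect to a given strict linear order. -/
theorem exists_forward_free (D n : ℕ) : ∃ N : ℕ, ∀ (V : Type u) (r : V → V → Prop)
    [IsStrictTotalOrder V r] (G : SimpleGraph V) (A : Finset V) (g : V → V),
    IsSparselyMatched G A g D → N ≤ #A →
    ∃ B ⊆ A, n ≤ #B ∧ ∀ a ∈ B, ∀ b ∈ B, r a b → ¬ G.Adj (g a) b := by
  classical
  obtain ⟨N, hN⟩ := exists_ramsey.{u} (D + 1) n
  refine ⟨N, fun V r _ G A g hA hcard => ?_⟩
  let := linearOrderOfSTO r
  -- Join `a` to a later `b` when `g a` sees `b`. In a clique of size `D + 1`, the partner of the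
  -- least element would see the whole clique, contradicting sparsity.
  obtain ⟨B, hBA, ⟨hBc, hB⟩ | ⟨hBc, hB⟩⟩ :=
    hN V (SimpleGraph.fromRel fun a b => r a b ∧ G.Adj (g a) b) A hcard
  · exfalso
    have hne : B.Nonempty := card_pos.1 (by omega)
    have hm := B.min'_mem hne
    refine (Nat.lt_of_lt_of_le (hA.card_lt _ (hBA hm)) ?_).false
    refine le_trans (by omega) (card_le_card (s := B) fun b hb => ?_)
    refine mem_filter.2 ⟨hBA hb, ?_⟩
    rcases eq_or_ne (B.min' hne) b with h | h
    · have := hA.adj _ (hBA hm)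
      rwa [← h]
    · have hlt : r (B.min' hne) b := lt_of_le_of_ne (B.min'_le b hb) h
      have := hB hm hb h
      rw [SimpleGraph.fromRel_adj] at this
      rcases this.2 with h' | h'
      · exact h'.2
      · exact absurd h'.1 (asymm hlt)
  · refine ⟨B, hBA, hBc, fun a ha b hb hab hadj => ?_⟩
    have hne : a ≠ b := fun h => irrefl_of r b (h ▸ hab)
    exact hB ha hb hne ((SimpleGraph.fromRel_adj _ _ _).2 ⟨hne, Or.inl ⟨hab, hadj⟩⟩)

/-- One pass along a well-order removes the edges from `g a` to later elements; a second pass along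
the reversed order removes those to earlier ones. -/
theorem exists_isInducedMatching (D n : ℕ) : ∃ N : ℕ, ∀ (V : Type u) (G : SimpleGraph V)
    (A : Finset V) (g : V → V), IsSparselyMatched G A g D → N ≤ #A →
    ∃ B ⊆ A, n ≤ #B ∧ IsInducedMatching G B g := by
  obtain ⟨N₁, h₁⟩ := exists_forward_free.{u} D n
  obtain ⟨N₂, h₂⟩ := exists_forward_free.{u} D N₁
  refine ⟨N₂, fun V G A g hA hcard => ?_⟩
  obtain ⟨B, hBA, hBc, hB⟩ := h₂ V WellOrderingRel G A g hA hcard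
  obtain ⟨C, hCB, hCc, hC⟩ := h₁ V (Function.swap WellOrderingRel) G B g (hA.mono hBA) hBc
  refine ⟨C, hCB.trans hBA, hCc, fun a ha b hb => ⟨fun hadj => ?_, ?_⟩,
    (hA.mono (hCB.trans hBA)).notMem⟩
  · rcases trichotomous_of (WellOrderingRel (α := V)) a b with h | h | h
    · exact absurd hadj (hB a (hCB ha) b (hCB hb) h)
    · exact h
    · exact absurd hadj (hC a ha b hb h)
  · rintro rfl
    exact hA.adj a (hBA (hCB ha))

theorem exists_fin_embedding {V : Type u} {A : Finset V} {n : ℕ} (h : n ≤ #A) :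
    ∃ e : Fin n → V, Function.Injective e ∧ ∀ i, e i ∈ A := by
  refine ⟨fun i => A.equivFin.symm (Fin.castLE h i), fun i j hij => ?_, fun i => by simp⟩
  simpa [Subtype.ext_iff] using hij

theorem IsInducedMatching.injOn {V : Type u} {G : SimpleGraph V} {A : Finset V} {g : V → V}
    (h : IsInducedMatching G A g) : Set.InjOn g A := fun a ha b hb hab =>
  (h.adj_iff a ha b hb).1 (hab ▸ (h.adj_iff b hb b hb).2 rfl)

/-- When each side is a clique or independent, any choice of `n` matching edges induces the same
graph, so `hl` and `hr` need not relate the indices to the vertices. -/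
theorem IsInducedMatching.isIndContained {V : Type u} {G : SimpleGraph V} {A : Finset V}
    {g : V → V} {n : ℕ} (h : IsInducedMatching G A g) (hn : n ≤ #A)
    {X : SimpleGraph (Fin n ⊕ Fin n)}
    (hl : ∀ i j, i ≠ j → ∀ a ∈ A, ∀ b ∈ A, a ≠ b →
      (G.Adj a b ↔ X.Adj (.inl i) (.inl j)))
    (hr : ∀ i j, i ≠ j → ∀ a ∈ A, ∀ b ∈ A, a ≠ b →
      (G.Adj (g a) (g b) ↔ X.Adj (.inr i) (.inr j)))
    (hrl : ∀ i j, X.Adj (.inr i) (.inl j) ↔ i = j) : X ⊴ G := by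
  obtain ⟨e, he, heA⟩ := exists_fin_embedding hn
  refine ⟨⟨⟨Sum.elim e (g ∘ e), ?_⟩, ?_⟩⟩
  · refine he.sumElim (fun i j hij => he (h.injOn (heA i) (heA j) hij)) fun i j hij => ?_
    exact h.notMem _ (heA j) (by rw [← Function.comp_apply (f := g), ← hij]; exact heA i)
  · have key : ∀ i j, G.Adj (g (e i)) (e j) ↔ X.Adj (.inr i) (.inl j) := fun i j => by
      rw [h.adj_iff _ (heA i) _ (heA j), he.eq_iff, hrl]
    rintro (i | i) (j | j)
    · rcases eq_or_ne i j with rfl | hij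
      · simp
      · exact hl i j hij _ (heA i) _ (heA j) (he.ne hij)
    · rw [SimpleGraph.adj_comm, SimpleGraph.adj_comm X]
      exact key j i
    · exact key i j
    · rcases eq_or_ne i j with rfl | hij
      · simp
      · exact hr i j hij _ (heA i) _ (heA j) (he.ne hij)

/-- In a graph with neither `CK_n` nor `K_n^*`, large sparse matchings contain large induced
matchings without any further edges. -/
theorem exists_isIndepSet_matching (n D m : ℕ) : ∃ N : ℕ, ∀ (V : Type u) (G : SimpleGraph V),
    ¬ matchedCliques n ⊴ G → ¬ cliqueWithPendants n ⊴ G → ∀ (A : Finset V) (g : V → V),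
    IsSparselyMatched G A g D → N ≤ #A →
    ∃ B ⊆ A, m ≤ #B ∧ IsInducedMatching G B g ∧ G.IsIndepSet B ∧
      ∀ a ∈ B, ∀ b ∈ B, ¬ G.Adj (g a) (g b) := by
  -- The bound `n + m` serves both uses of an independent `g(E)`: `n` pendants of `K_n^*`, or an
  -- output of size `m`.
  obtain ⟨N₁, h₁⟩ := exists_ramsey.{u} n (n + m)
  obtain ⟨N₂, h₂⟩ := exists_ramsey.{u} N₁ N₁
  obtain ⟨N₃, h₃⟩ := exists_isInducedMatching.{u} D N₂
  refine ⟨N₃, fun V G hCK hKs A g hA hcard => ?_⟩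
  obtain ⟨B, hBA, hBc, hB⟩ := h₃ V G A g hA hcard
  have hr : ∀ {C : Finset V}, N₁ ≤ #C → ∃ E ⊆ C, (n ≤ #E ∧ (G.comap g).IsClique E) ∨
    (n + m ≤ #E ∧ (G.comap g).IsIndepSet E) := h₁ V (G.comap g) _
  obtain ⟨C, hCB, ⟨hCc, hC⟩ | ⟨hCc, hC⟩⟩ := h₂ V G B hBc <;>
    obtain ⟨E, hEC, ⟨hEc, hE⟩ | ⟨hEc, hE⟩⟩ := hr hCc
  · refine absurd ((hB.mono (hEC.trans hCB)).isIndContained hEc ?_ ?_ ?_) hCK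
    · exact fun i j hij a ha b hb hab => iff_of_true (hC (hEC ha) (hEC hb) hab) hij
    · exact fun i j hij a ha b hb hab => iff_of_true (hE ha hb hab) hij
    · exact fun i j => Iff.rfl
  · refine absurd ((hB.mono (hEC.trans hCB)).isIndContained (by omega) ?_ ?_ ?_) hKs
    · exact fun i j hij a ha b hb hab => iff_of_true (hC (hEC ha) (hEC hb) hab) hij
    · exact fun i j hij a ha b hb hab => iff_of_false (hE ha hb hab) id
    · exact fun i j => Iff.rfl.trans eq_comm
  -- Here the clique is on the side of `g`, so the two sides of `K_n^*` are swapped.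
  · refine absurd (SimpleGraph.IsIndContained.trans
      ⟨(SimpleGraph.Iso.comap (Equiv.sumComm _ _) (cliqueWithPendants n)).symm.toEmbedding⟩
      ((hB.mono (hEC.trans hCB)).isIndContained hEc ?_ ?_ ?_)) hKs
    · exact fun i j hij a ha b hb hab => iff_of_false (hC (hEC ha) (hEC hb) hab) id
    · exact fun i j hij a ha b hb hab => iff_of_true (hE ha hb hab) hij
    · exact fun i j => Iff.rfl
  · refine ⟨E, hEC.trans (hCB.trans hBA), by omega, hB.mono (hEC.trans hCB),
      Set.Pairwise.mono hEC hC, fun a ha b hb => ?_⟩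
    rcases eq_or_ne a b with rfl | hab
    · simp
    · exact hE ha hb hab

theorem spider_isIndContained {V : Type u} {G : SimpleGraph V} {n : ℕ} {w : V}
    {p q : Fin n → V} (hwp : ∀ i, G.Adj w (p i)) (hwq : ∀ i, ¬ G.Adj w (q i))
    (hne : ∀ i, w ≠ q i) (hpp : ∀ i j, ¬ G.Adj (p i) (p j)) (hqq : ∀ i j, ¬ G.Adj (q i) (q j))
    (hpq : ∀ i j, G.Adj (p i) (q j) ↔ i = j) : spider n ⊴ G := by
  have hp : Function.Injective p := fun i j hij =>
    (hpq i j).1 (hij ▸ (hpq j j).2 rfl)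
  have hq : Function.Injective q := fun i j hij =>
    (hpq i j).1 (hij ▸ (hpq i i).2 rfl)
  refine ⟨⟨⟨Sum.elim (Sum.elim (fun _ => w) p) q, ?_⟩, ?_⟩⟩
  · refine Function.Injective.sumElim (Function.Injective.sumElim
      (fun _ _ _ => Subsingleton.elim _ _) hp fun _ i => (hwp i).ne) hq ?_
    rintro (_ | i) j
    · exact hne j
    · exact fun h => hwq j (h ▸ hwp i)
  · have hpw := fun i => (hwp i).symm
    have hqw : ∀ i, ¬ G.Adj (q i) w := fun i h => hwq i h.symm
    have hqp : ∀ i j, G.Adj (q i) (p j) ↔ j = i := fun i j => by rw [G.adj_comm, hpq]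
    rintro ((i | i) | i) ((j | j) | j) <;>
      simp [spider, addPendants, hwp, hwq, hpp, hqq, hpq, hpw, hqw, hqp]

/-- In a graph without `CK_n`, `K_n^*` and `K_{1,n}^*`, no vertex is complete to one side and
anticomplete to the other side of a large sparse matching. -/
theorem card_lt_of_isSparselyMatched (n D : ℕ) : ∃ N : ℕ, ∀ (V : Type u) (G : SimpleGraph V),
    ¬ matchedCliques n ⊴ G → ¬ cliqueWithPendants n ⊴ G → ¬ spider n ⊴ G →
    ∀ (A : Finset V) (g : V → V) (w : V), IsSparselyMatched G A g D →
    ((∀ a ∈ A, G.Adj w a ∧ ¬ G.Adj w (g a) ∧ w ≠ g a) ∨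
      (∀ a ∈ A, G.Adj w (g a) ∧ ¬ G.Adj w a ∧ w ≠ a)) → #A < N := by
  obtain ⟨N, hN⟩ := exists_isIndepSet_matching.{u} n D n
  refine ⟨N, fun V G hCK hKs hsp A g w hA hw => ?_⟩
  by_contra! hcard
  obtain ⟨B, hBA, hBc, hB, hBi, hBg⟩ := hN V G hCK hKs A g hA hcard
  obtain ⟨e, he, heB⟩ := exists_fin_embedding hBc
  have hee : ∀ i j, ¬ G.Adj (e i) (e j) := fun i j => by
    rcases eq_or_ne i j with rfl | hij
    · simp
    · exact hBi (heB i) (heB j) (he.ne hij)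
  have hgg : ∀ i j, ¬ G.Adj (g (e i)) (g (e j)) := fun i j => hBg _ (heB i) _ (heB j)
  have hge : ∀ i j, G.Adj (g (e i)) (e j) ↔ i = j := fun i j => by
    rw [hB.adj_iff _ (heB i) _ (heB j), he.eq_iff]
  refine hsp (hw.elim (fun hw => ?_) fun hw => ?_)
  · have := fun i => hw (e i) (hBA (heB i))
    exact spider_isIndContained (fun i => (this i).1) (fun i => (this i).2.1)
      (fun i => (this i).2.2) hee hgg fun i j => by rw [SimpleGraph.adj_comm, hge, eq_comm]
  · have := fun i => hw (e i) (hBA (heB i))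
    exact spider_isIndContained (fun i => (this i).1) (fun i => (this i).2.1)
      (fun i => (this i).2.2) hgg hee hge

/-! ### Distance layers. -/

theorem SimpleGraph.Connected.exists_adj_dist_eq {V : Type u} {G : SimpleGraph V}
    (hG : G.Connected) {r v : V} {i : ℕ} (h : G.dist r v = i + 1) :
    ∃ w, G.Adj w v ∧ G.dist r w = i := by
  obtain ⟨p, hp⟩ := hG.exists_walk_length_eq_dist v r
  rw [G.dist_comm, h] at hp
  cases p with
  | nil => simp at hp
  | cons hvw p =>
    rename_i w
    refine ⟨w, hvw.symm, ?_⟩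
    have h₁ := G.dist_le p
    have h₂ := hG.dist_triangle (u := r) (v := w) (w := v)
    rw [SimpleGraph.dist_eq_one_iff_adj.2 hvw.symm, h] at h₂
    rw [SimpleGraph.Walk.length_cons] at hp
    rw [G.dist_comm] at h₁
    omega

theorem SimpleGraph.Connected.exists_geodesic {V : Type u} {G : SimpleGraph V}
    (hG : G.Connected) (r : V) (d : ℕ) : ∀ v, G.dist r v = d →
    ∃ f : ℕ → V, f d = v ∧ (∀ j ≤ d, G.dist r (f j) = j) ∧ ∀ j < d, G.Adj (f j) (f (j + 1)) := by
  induction d with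
  | zero => exact fun v hv => ⟨fun _ => v, rfl, fun j hj => by simpa [Nat.le_zero.1 hj] using hv,
      by simp⟩
  | succ d ih =>
    intro v hv
    obtain ⟨w, hwv, hw⟩ := hG.exists_adj_dist_eq hv
    obtain ⟨f, rfl, hf, hadj⟩ := ih w hw
    refine ⟨Function.update f (d + 1) v, by simp, fun j hj => ?_, fun j hj => ?_⟩
    · rcases hj.eq_or_lt with rfl | hj
      · simpa using hv
      · rw [Function.update_of_ne (by omega)]
        exact hf j (by omega)
    · rw [Function.update_of_ne (by omega)]
      rcases (Nat.lt_succ_iff.1 hj).eq_or_lt with rfl | hj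
      · simpa using hwv
      · rw [Function.update_of_ne (by omega)]
        exact hadj j hj

/-- A geodesic is an induced path: adjacent vertices differ by at most one in their distance from
`r`. -/
theorem SimpleGraph.Connected.dist_lt_of_not_pathGraph {V : Type u} {G : SimpleGraph V}
    (hG : G.Connected) {n : ℕ} (hP : ¬ SimpleGraph.pathGraph n ⊴ G) (r v : V) :
    G.dist r v < n := by
  by_contra! h
  obtain ⟨f, -, hf, hadj⟩ := hG.exists_geodesic r _ v rfl
  have hd : ∀ i : Fin n, G.dist r (f i) = i := fun i => hf i (by omega)
  refine hP ⟨⟨⟨fun i => f i, fun i j hij => ?_⟩, ?_⟩⟩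
  · have := congrArg (G.dist r) hij
    rw [hd, hd] at this
    exact Fin.ext this
  · intro i j
    change G.Adj (f i) (f j) ↔ _
    rw [SimpleGraph.pathGraph_adj]
    refine ⟨fun hij => ?_, ?_⟩
    · have h₁ := hG.dist_triangle (u := r) (v := f i) (w := f j)
      have h₂ := hG.dist_triangle (u := r) (v := f j) (w := f i)
      rw [SimpleGraph.dist_eq_one_iff_adj.2 hij, hd, hd] at h₁
      rw [SimpleGraph.dist_eq_one_iff_adj.2 hij.symm, hd, hd] at h₂
      have : (i : ℕ) ≠ j := fun h => hij.ne (by rw [h])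
      omega
    · rintro (hij | hij) <;> rw [← hij]
      · exact hadj i (by omega)
      · exact (hadj j (by omega)).symm

open scoped Classical in
/-- In a connected graph without `CK_n`, `K_n^*` and `K_{1,n}^*`, every large set of vertices at
the same distance from a root contains many neighbours of a single vertex. -/
theorem exists_le_card_filter_adj_of_dist_eq (n i D : ℕ) : ∃ M : ℕ, ∀ (V : Type u)
    (G : SimpleGraph V), G.Connected → ¬ matchedCliques n ⊴ G → ¬ cliqueWithPendants n ⊴ G →
    ¬ spider n ⊴ G → ∀ (r : V) (S : Finset V), (∀ s ∈ S, G.dist r s = i) → M ≤ #S →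
    ∃ w, D ≤ #{s ∈ S | G.Adj w s} := by
  induction i generalizing D with
  | zero =>
    refine ⟨2, fun V G hG _ _ _ r S hS hcard => ?_⟩
    obtain ⟨a, ha, b, hb, hab⟩ := one_lt_card.1 hcard
    exact absurd ((hG.dist_eq_zero_iff.1 (hS a ha)).symm.trans (hG.dist_eq_zero_iff.1 (hS b hb)))
      hab
  | succ i ih =>
    obtain ⟨N, hN⟩ := card_lt_of_isSparselyMatched.{u} n D
    -- Among the children of neighbours of `w`, fewer than `D` are adjacent to `w` and one may be
    -- `w` itself; the rest must still number at least `N`.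
    obtain ⟨M, hM⟩ := ih (N + D + 1)
    refine ⟨(D + 1) * M, fun V G hG hCK hKs hsp r S hS hcard => ?_⟩
    by_contra! hlt
    have hpar : ∀ s : V, ∃ w, s ∈ S → G.Adj w s ∧ G.dist r w = i := fun s => by
      by_cases hs : s ∈ S
      · obtain ⟨w, hw⟩ := hG.exists_adj_dist_eq (hS s hs)
        exact ⟨w, fun _ => hw⟩
      · exact ⟨s, fun h => absurd h hs⟩
    choose g hg using hpar
    -- `g` picks a parent in the previous layer. No vertex sees `D` elements of `S`, so there are
    -- many distinct parents, and the matching of `S` with them is sparse.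
    have himg : #S ≤ D * #(S.image g) := card_le_mul_card_image S D fun w hw =>
      (card_le_card fun s hs => by
        rw [mem_filter] at hs ⊢
        exact ⟨hs.1, hs.2 ▸ (hg s hs.1).1⟩).trans (hlt w).le
    have hMimg : M ≤ #(S.image g) := by
      refine Nat.le_of_mul_le_mul_left (hcard.trans (himg.trans ?_)) D.succ_pos
      exact Nat.mul_le_mul_right _ D.le_succ
    obtain ⟨w, hw⟩ := hM V G hG hCK hKs hsp r (S.image g) (by
      simp only [mem_image]
      rintro _ ⟨s, hs, rfl⟩
      exact (hg s hs).2) hMimg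
    have hA : N + D + 1 ≤ #{s ∈ S | G.Adj w (g s)} := hw.trans <| by
      refine (card_le_card fun x hx => ?_).trans (card_image_le (f := g))
      obtain ⟨hx, hwx⟩ := mem_filter.1 hx
      obtain ⟨s, hs, rfl⟩ := mem_image.1 hx
      exact mem_image_of_mem _ (mem_filter.2 ⟨hs, hwx⟩)
    have hsplit : #{s ∈ {s ∈ S | G.Adj w (g s)} | G.Adj w s} +
        #{s ∈ {s ∈ S | G.Adj w (g s)} | ¬ G.Adj w s} = #{s ∈ S | G.Adj w (g s)} :=
      card_filter_add_card_filter_not _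
    have hnear : #{s ∈ {s ∈ S | G.Adj w (g s)} | G.Adj w s} < D :=
      (card_le_card (filter_subset_filter _ (filter_subset _ _))).trans_lt (hlt w)
    have herase := pred_card_le_card_erase (a := w)
      (s := {s ∈ {s ∈ S | G.Adj w (g s)} | ¬ G.Adj w s})
    have hsub : ({s ∈ {s ∈ S | G.Adj w (g s)} | ¬ G.Adj w s} : Finset V).erase w ⊆ S :=
      (erase_subset _ _).trans ((filter_subset _ _).trans (filter_subset _ _))
    have hfew := hN V G hCK hKs hsp _ g w
      ⟨fun s hs => (hg s (hsub hs)).1, fun s hs hgs => by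
        have h₁ := (hg s (hsub hs)).2
        have h₂ := hS _ (hsub hgs)
        omega, fun s hs => (card_le_card (filter_subset_filter _ hsub)).trans_lt (hlt (g s))⟩
      (Or.inr fun s hs => by
        obtain ⟨hsw, hs⟩ := mem_erase.1 hs
        obtain ⟨hs, hws⟩ := mem_filter.1 hs
        exact ⟨(mem_filter.1 hs).2, hws, hsw.symm⟩)
    omega

/-! ### Cliques and independent sets of vertices with disconnected neighbourhood. -/

/-- Every neighbour `x` of `v` has a neighbour `y` of `v` at distance more than two from it in
the subgraph induced by the neighbourhood of `v`. -/
def HasFarNeighbors {V : Type u} (G : SimpleGraph V) (v : V) : Prop :=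
  ∀ x, G.Adj v x → ∃ y, G.Adj v y ∧ ∀ z, G.Adj v z → z = x ∨ G.Adj z x → z ≠ y ∧ ¬ G.Adj z y

theorem hasFarNeighbors_of_two_le (G : FinGraph.{u}) (v : G.V)
    (h : 2 ≤ localComponentNumber G v) : HasFarNeighbors G.graph v := by
  intro x hx
  have : Finite (G.graph.induce (G.graph.neighborSet v)).ConnectedComponent :=
    Nat.finite_of_card_ne_zero (by unfold localComponentNumber at h; omega)
  have := Finite.one_lt_card_iff_nontrivial.1 (show 1 < localComponentNumber G v from h)
  obtain ⟨c, hc⟩ :=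
    exists_ne ((G.graph.induce (G.graph.neighborSet v)).connectedComponentMk ⟨x, hx⟩)
  induction c using SimpleGraph.ConnectedComponent.ind with | h y => ?_
  obtain ⟨y, hy⟩ := y
  refine ⟨y, hy, fun z hz hzx => ?_⟩
  have hreach : (G.graph.induce (G.graph.neighborSet v)).Reachable ⟨z, hz⟩ ⟨x, hx⟩ := by
    rcases hzx with rfl | hzx
    · rfl
    · exact SimpleGraph.Adj.reachable (by simpa using hzx)
  refine ⟨?_, fun hzy => hc (SimpleGraph.ConnectedComponent.sound ?_)⟩
  · rintro rfl
    exact hc (SimpleGraph.ConnectedComponent.sound hreach)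
  · refine SimpleGraph.Reachable.trans (SimpleGraph.Adj.reachable ?_) hreach
    simpa using hzy.symm

/-- The rest of the clique lies within distance one of any `x` in it, so the far neighbour `g a`
misses all of it except `a`. This sparse matching has `D = 2`, and two independent vertices from it
already contradict the clique. -/
theorem card_clique_lt_of_hasFarNeighbors (n : ℕ) : ∃ N : ℕ, ∀ (V : Type u) (G : SimpleGraph V),
    ¬ matchedCliques n ⊴ G → ¬ cliqueWithPendants n ⊴ G →
    ∀ A : Finset V, G.IsClique A → (∀ a ∈ A, HasFarNeighbors G a) → #A < N := by
  classical
  obtain ⟨N, hN⟩ := exists_isIndepSet_matching.{u} n 2 2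
  refine ⟨N + 2, fun V G hCK hKs A hA hfar => ?_⟩
  by_contra! hcard
  have hg : ∀ a : V, ∃ y, a ∈ A → G.Adj y a ∧ ∀ z ∈ A, z ≠ a → z ≠ y ∧ ¬ G.Adj z y := by
    intro a
    by_cases ha : a ∈ A
    · obtain ⟨x, hx, hxa⟩ := exists_mem_ne (by omega : 1 < #A) a
      obtain ⟨y, hy, hyz⟩ := hfar a ha x (hA ha hx hxa.symm)
      refine ⟨y, fun _ => ⟨hy.symm, fun z hz hza => hyz z (hA ha hz hza.symm) ?_⟩⟩
      exact (eq_or_ne z x).imp_right (hA hz hx)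
    · exact ⟨a, fun h => absurd h ha⟩
  choose g hg using hg
  have hsparse : IsSparselyMatched G A g 2 := by
    refine ⟨fun a ha => (hg a ha).1,
      fun a ha hga => ((hg a ha).2 _ hga (hg a ha).1.ne).1 rfl, fun a ha => ?_⟩
    have : ∀ b ∈ A, G.Adj (g a) b → b = a := fun b hb hgb => by
      by_contra hba
      exact ((hg a ha).2 b hb hba).2 hgb.symm
    refine Nat.lt_succ_of_le (card_le_one.2 fun b hb c hc => ?_)
    rw [mem_filter] at hb hc
    rw [this b hb.1 hb.2, this c hc.1 hc.2]
  obtain ⟨B, hBA, hBc, -, hB, -⟩ := hN V G hCK hKs A g hsparse (by omega)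
  obtain ⟨a, ha, b, hb, hab⟩ := one_lt_card.1 hBc
  exact hB ha hb hab (hA (hBA ha) (hBA hb) hab)

/-- Let `g a` be a neighbour of `a` far from `w`. If `g a` had `n` neighbours in `A`, then these
with `w` and `g a` would induce `K_{2,n}`; hence the matching is sparse, and `w` is complete to `A`
and anticomplete to `g(A)`. -/
theorem card_indepSet_lt_of_hasFarNeighbors (n : ℕ) : ∃ N : ℕ, ∀ (V : Type u)
    (G : SimpleGraph V), ¬ matchedCliques n ⊴ G → ¬ cliqueWithPendants n ⊴ G →
    ¬ spider n ⊴ G → ¬ completeBipartiteGraph (Fin 2) (Fin n) ⊴ G →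
    ∀ (A : Finset V) (w : V), G.IsIndepSet A → (∀ a ∈ A, G.Adj w a ∧ HasFarNeighbors G a) →
    #A < N := by
  obtain ⟨N, hN⟩ := card_lt_of_isSparselyMatched.{u} n n
  refine ⟨N, fun V G hCK hKs hsp hKb A w hA hfar => ?_⟩
  have hg : ∀ a : V, ∃ y, a ∈ A → G.Adj y a ∧ w ≠ y ∧ ¬ G.Adj w y := by
    intro a
    by_cases ha : a ∈ A
    · obtain ⟨y, hy, hyz⟩ := (hfar a ha).2 w (hfar a ha).1.symm
      exact ⟨y, fun _ => ⟨hy.symm, hyz w (hfar a ha).1.symm (Or.inl rfl)⟩⟩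
    · exact ⟨a, fun h => absurd h ha⟩
  choose g hg using hg
  refine hN V G hCK hKs hsp A g w ⟨fun a ha => (hg a ha).1,
    fun a ha hga => (hg a ha).2.2 (hfar _ hga).1, fun a ha => ?_⟩
    (Or.inl fun a ha => ⟨(hfar a ha).1, (hg a ha).2.2, (hg a ha).2.1⟩)
  by_contra! hcard
  obtain ⟨e, he, heA⟩ := exists_fin_embedding hcard
  simp only [mem_filter] at heA
  have hee : ∀ i j, ¬ G.Adj (e i) (e j) := fun i j => by
    rcases eq_or_ne i j with rfl | hij
    · simp
    · exact hA (heA i).1 (heA j).1 (he.ne hij)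
  have hwe := fun i => (hfar _ (heA i).1).1
  have hge := fun i => (heA i).2
  have hwg := (hg a ha).2.2
  refine hKb ⟨⟨⟨Sum.elim ![w, g a] e, Function.Injective.sumElim ?_ he ?_⟩, ?_⟩⟩
  · intro i j
    have := (hg a ha).2.1
    fin_cases i <;> fin_cases j <;> simp [this, this.symm]
  · intro i j
    fin_cases i
    · exact (hwe j).ne
    · exact (hge j).ne
  · rintro (i | i) (j | j)
    · fin_cases i <;> fin_cases j <;> simp [hwg, G.adj_comm (g a) w]
    · fin_cases i <;> simp [hwe, hge]
    · fin_cases j <;> simp [G.adj_comm (e i), hwe, hge]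
    · simp [hee]

/-- A connected graph without large members of the unavoidable family has few vertices whose
neighbourhood is disconnected. -/
theorem card_hasFarNeighbors_lt (n : ℕ) : ∃ c : ℕ, ∀ (V : Type u) (G : SimpleGraph V),
    G.Connected → ¬ matchedCliques n ⊴ G → ¬ cliqueWithPendants n ⊴ G → ¬ spider n ⊴ G →
    ¬ completeBipartiteGraph (Fin 2) (Fin n) ⊴ G → ¬ SimpleGraph.pathGraph n ⊴ G →
    ∀ S : Finset V, (∀ s ∈ S, HasFarNeighbors G s) → #S < c := by
  classical
  obtain ⟨N₁, h₁⟩ := card_clique_lt_of_hasFarNeighbors.{u} n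
  obtain ⟨N₂, h₂⟩ := card_indepSet_lt_of_hasFarNeighbors.{u} n
  obtain ⟨D, hD⟩ := exists_ramsey.{u} N₁ N₂
  choose M hM using fun i => exists_le_card_filter_adj_of_dist_eq.{u} n i D
  refine ⟨n * (range n).sup M + 1, fun V G hG hCK hKs hsp hKb hP S hS => ?_⟩
  by_contra! hcard
  obtain ⟨r⟩ := hG.nonempty
  obtain ⟨i, hi, hic⟩ := exists_lt_card_fiber_of_mul_lt_card_of_maps_to (s := S) (t := range n)
    (f := G.dist r) (n := (range n).sup M)
    (fun s _ => mem_range.2 (hG.dist_lt_of_not_pathGraph hP r s)) (by rw [card_range]; omega)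
  obtain ⟨w, hw⟩ := hM i V G hG hCK hKs hsp r _ (fun s hs => (mem_filter.1 hs).2)
    ((le_sup hi).trans hic.le)
  have hmem : ∀ {s}, s ∈ ({s ∈ {s ∈ S | G.dist r s = i} | G.Adj w s} : Finset V) →
      G.Adj w s ∧ HasFarNeighbors G s := fun {s} hs => by
    simp only [mem_filter] at hs
    exact ⟨hs.2, hS s hs.1.1⟩
  obtain ⟨B, hBA, ⟨hBc, hB⟩ | ⟨hBc, hB⟩⟩ := hD V G _ hw
  · exact (h₁ V G hCK hKs B hB fun b hb => (hmem (hBA hb)).2).not_ge hBc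
  · exact (h₂ V G hCK hKs hsp hKb B w hB fun b hb => hmem (hBA hb)).not_ge hBc

/-! ### The six families have many vertices with disconnected neighbourhood. -/

theorem two_le_localComponentNumber (G : FinGraph.{u}) {v x y : G.V} (hx : G.graph.Adj v x)
    (hy : G.graph.Adj v y) (hxy : x ≠ y) (h : ∀ z, G.graph.Adj v z → ¬ G.graph.Adj y z) :
    2 ≤ localComponentNumber G v := by
  have := G.finite
  let C := (G.graph.induce (G.graph.neighborSet v)).connectedComponentMk
  have hne : C ⟨y, hy⟩ ≠ C ⟨x, hx⟩ := by
    intro heq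
    obtain ⟨p⟩ := SimpleGraph.ConnectedComponent.exact heq
    cases p with
    | nil => exact hxy rfl
    | cons hyz p => exact h _ (Subtype.property _) (by simpa using hyz)
  exact Finite.one_lt_card_iff_nontrivial.2 ⟨_, _, hne⟩

/-- A family whose free connected graphs have fewer than `c` vertices with disconnected
neighbourhood contains an induced subgraph of any connected graph with at least `c` vertices that
have an isolated vertex in their neighbourhood. -/
theorem exists_prec_of_connected {𝓗 : Set FinGraph.{u}} {c : ℕ}
    (hc : ∀ G : FinGraph.{u}, G.graph.Connected → G.IsFree 𝓗 →
      countGE localComponentNumber 2 G < c)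
    {W : Type} [Finite W] (X : SimpleGraph W) (hX : X.Connected) (f : Fin c → W)
    (hf : Function.Injective f)
    (h : ∀ i, ∃ x y, X.Adj (f i) x ∧ X.Adj (f i) y ∧ x ≠ y ∧ ∀ z, X.Adj (f i) z → ¬ X.Adj y z) :
    ∃ H ∈ 𝓗, H.Prec (FinGraph.of X) := by
  -- The bound concerns graphs in universe `u`, so `X` is lifted there.
  let e : X.comap (Equiv.ulift.{u} : ULift.{u} W ≃ W) ≃g X := SimpleGraph.Iso.comap _ X
  let G : FinGraph.{u} := FinGraph.of (X.comap (Equiv.ulift.{u} : ULift.{u} W ≃ W))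
  by_contra! hfree
  have hlt := hc G (e.connected_iff.2 hX) fun H hH hHG =>
    hfree H hH (hHG.trans ⟨e.toEmbedding⟩)
  refine hlt.not_ge ?_
  have := G.finite
  calc c = (Set.range (ULift.up.{u} ∘ f)).ncard := by
        rw [← Set.image_univ, Set.ncard_image_of_injective _ (ULift.up_injective.comp hf),
          Set.ncard_univ, Nat.card_eq_fintype_card, Fintype.card_fin]
    _ ≤ _ := by
        refine Set.ncard_le_ncard ?_ (Set.toFinite _)
        rintro _ ⟨i, rfl⟩
        obtain ⟨x, y, hx, hy, hxy, hz⟩ := h i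
        exact two_le_localComponentNumber G (x := ULift.up x) (y := ULift.up y) hx hy
          (fun h => hxy (ULift.up_injective h)) fun z => hz z.down

theorem addPendants_connected {V : Type u} {ι : Type v} {G : SimpleGraph V} (hG : G.Connected)
    (f : ι → V) : (addPendants G f).Connected := by
  obtain ⟨r⟩ := hG.nonempty
  have hl : ∀ a, (addPendants G f).Reachable (.inl r) (.inl a) := fun a =>
    (hG.preconnected r a).map (⟨Sum.inl, id⟩ : G →g addPendants G f)
  refine SimpleGraph.connected_iff_exists_forall_reachable _ |>.2 ⟨.inl r, ?_⟩
  rintro (a | i)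
  · exact hl a
  · exact (hl (f i)).trans (SimpleGraph.Adj.reachable (show f i = f i from rfl))

theorem addVertex_connected {V : Type u} {G : SimpleGraph V} (hG : G.Connected) {S : Set V}
    (hS : S.Nonempty) : (addVertex G S).Connected := by
  obtain ⟨s, hs⟩ := hS
  have hl : ∀ a, (addVertex G S).Reachable (some s) (some a) := fun a =>
    (hG.preconnected s a).map (⟨some, id⟩ : G →g addVertex G S)
  refine SimpleGraph.connected_iff_exists_forall_reachable _ |>.2 ⟨some s, ?_⟩
  rintro (_ | a)
  · exact SimpleGraph.Adj.reachable (show s ∈ S from hs)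
  · exact hl a

theorem completeBipartiteGraph_connected {V : Type u} {W : Type v} [Nonempty V] [Nonempty W] :
    (completeBipartiteGraph V W).Connected := by
  obtain ⟨v₀⟩ := ‹Nonempty V›
  obtain ⟨w₀⟩ := ‹Nonempty W›
  have hr : ∀ v w, (completeBipartiteGraph V W).Reachable (.inl v) (.inr w) := fun v w =>
    SimpleGraph.Adj.reachable (by simp)
  refine SimpleGraph.connected_iff_exists_forall_reachable _ |>.2 ⟨.inl v₀, ?_⟩
  rintro (v | w)
  · exact (hr v₀ w₀).trans (hr v w₀).symm
  · exact hr v₀ w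

theorem graphJoin_connected {V : Type u} {W : Type v} [Nonempty V] [Nonempty W]
    (G : SimpleGraph V) (H : SimpleGraph W) : (graphJoin G H).Connected :=
  completeBipartiteGraph_connected.mono le_sup_right

theorem matchedCliques_connected (n : ℕ) : (matchedCliques (n + 1)).Connected := by
  refine SimpleGraph.connected_iff_exists_forall_reachable _ |>.2 ⟨.inl 0, ?_⟩
  have hl : ∀ i, (matchedCliques (n + 1)).Reachable (.inl 0) (.inl i) := fun i => by
    rcases eq_or_ne 0 i with rfl | h
    · rfl
    · exact SimpleGraph.Adj.reachable h
  rintro (i | i)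
  · exact hl i
  · exact (hl i).trans (SimpleGraph.Adj.reachable (show i = i from rfl))

theorem familyLE_of_mem_B₁ {𝓗 : Set FinGraph.{u}} (h : 𝓗 ∈ B₁ localComponentNumber.{u}) :
    ∃ n : ℕ, 0 < n ∧ FamilyLE 𝓗 (unavoidableFamily n) := by
  obtain ⟨c, hc⟩ := h
  have hcast : Function.Injective (Fin.castLE (by omega : c ≤ c + 2)) :=
    Fin.castLE_injective _
  have hother : ∀ i : Fin (c + 2), ∃ j, j ≠ i := fun i => exists_ne i
  -- The path needs two extra vertices, as only its `c` inner vertices count; in the cliques the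
  -- surplus provides a second vertex `j ≠ i`.
  refine ⟨c + 2, by omega, ?_⟩
  rintro _ (rfl | rfl | rfl | rfl | rfl | rfl)
  · refine exists_prec_of_connected hc _ (addPendants_connected SimpleGraph.connected_top _)
      (fun i => .inl (Fin.castLE (by omega) i)) (Sum.inl_injective.comp hcast) fun i => ?_
    obtain ⟨j, hj⟩ := hother (Fin.castLE (by omega) i)
    refine ⟨.inl j, .inr (Fin.castLE (by omega) i), hj.symm, rfl, by simp, ?_⟩
    rintro (z | z) hz hyz
    · exact hz (Eq.symm hyz)
    · exact hyz
  · refine exists_prec_of_connected hc _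
      (addPendants_connected completeBipartiteGraph_connected _)
      (fun i => .inl (.inr (Fin.castLE (by omega) i)))
      (Sum.inl_injective.comp (Sum.inr_injective.comp hcast)) fun i => ?_
    refine ⟨.inl (.inl 0), .inr (Fin.castLE (by omega) i), Or.inr (by simp), rfl, by simp, ?_⟩
    rintro (z | z) hz hyz
    · obtain rfl : z = _ := hyz
      exact SimpleGraph.irrefl _ hz
    · exact hyz
  · refine exists_prec_of_connected hc _ (SimpleGraph.pathGraph_connected _)
      (fun i => ⟨i + 1, by omega⟩) (fun i j hij => by simpa [Fin.ext_iff] using hij) fun i => ?_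
    refine ⟨⟨i, by omega⟩, ⟨i + 2, by omega⟩, ?_⟩
    simp only [SimpleGraph.pathGraph_adj, ne_eq, Fin.mk.injEq]
    refine ⟨Or.inr trivial, Or.inl trivial, by omega, fun z => by omega⟩
  · refine exists_prec_of_connected hc _ completeBipartiteGraph_connected
      (fun i => .inr (Fin.castLE (by omega) i)) (Sum.inr_injective.comp hcast) fun i => ?_
    refine ⟨.inl 0, .inl 1, by simp, by simp, by simp, ?_⟩
    rintro (z | z) <;> simp
  · refine exists_prec_of_connected hc _ (matchedCliques_connected _)
      (fun i => .inl (Fin.castLE (by omega) i)) (Sum.inl_injective.comp hcast) fun i => ?_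
    obtain ⟨j, hj⟩ := hother (Fin.castLE (by omega) i)
    refine ⟨.inl j, .inr (Fin.castLE (by omega) i), hj.symm, rfl, by simp, ?_⟩
    rintro (z | z) hz hyz
    · exact hz hyz
    · exact hyz hz
  · refine exists_prec_of_connected hc _
      (addVertex_connected (graphJoin_connected _ _) (Set.range_nonempty _))
      (fun i => some (.inr (Fin.castLE (by omega) i)))
      ((Option.some_injective _).comp (Sum.inr_injective.comp hcast)) fun i => ?_
    refine ⟨some (.inl 0), none, Or.inr (by simp), ⟨_, rfl⟩, by simp, ?_⟩
    rintro (_ | z) hz hyz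
    · exact hyz
    · obtain ⟨j, rfl⟩ := hyz
      change (graphJoin _ _).Adj _ _ at hz
      simp [graphJoin] at hz

theorem mem_B₁_of_familyLE {𝓗 : Set FinGraph.{u}} {n : ℕ}
    (h : FamilyLE 𝓗 (unavoidableFamily n)) : 𝓗 ∈ B₁ localComponentNumber.{u} := by
  obtain ⟨c, hc⟩ := card_hasFarNeighbors_lt.{u} n
  refine ⟨c, fun G hG hfree => ?_⟩
  have hnot : ∀ X ∈ unavoidableFamily n, ¬ X.graph ⊴ G.graph := fun X hX hXG => by
    obtain ⟨H, hH, hHX⟩ := h X hX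
    exact hfree H hH (hHX.trans hXG)
  have := G.finite
  rw [countGE, Set.ncard_eq_toFinset_card _ (Set.toFinite _)]
  refine hc G.V G.graph hG (hnot (.of (matchedCliques n)) (by simp [unavoidableFamily]))
    (hnot (.of (cliqueWithPendants n)) (by simp [unavoidableFamily]))
    (hnot (.of (spider n)) (by simp [unavoidableFamily]))
    (hnot (.of (completeBipartiteGraph (Fin 2) (Fin n))) (by simp [unavoidableFamily]))
    (hnot (.of (SimpleGraph.pathGraph n)) (by simp [unavoidableFamily])) _ fun s hs => ?_
  exact hasFarNeighbors_of_two_le G s (by simpa using hs)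

theorem mainTheorem3 (𝓗 : Set FinGraph.{u}) :
    𝓗 ∈ B₁ localComponentNumber.{u} ↔
      ∃ n : ℕ, 0 < n ∧ FamilyLE 𝓗 (unavoidableFamily n) := by
  exact ⟨familyLE_of_mem_B₁, fun ⟨_, _, h⟩ => mem_B₁_of_familyLE h⟩
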